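/- Let $H_1,H_2$ be infinite-dimensional separable complex Hilbert spaces, let $A_1\in\mathcal B(H_1)$ and $A_2\in\mathcal B(H_2)$ be positive operators, let $X\in\mathcal B(H_2,H_1)$, and suppose that the block operator $$T=\begin{bmatrix} A_1 & X\\ X^* & A_2\end{bmatrix}$$ on the Hilbert space direct sum $H_1\oplus H_2$ is positive. Call a bounded operator $S\in\mathcal B(H,K)$ absolutely norm attaining (an $\mathcal{AN}$-operator) if for every non-zero closed subspace $M$ of $H$ there is a unit vector $x\in M$ with $\|Sx\|=\|S|_M\|$, and write $\sigma_{ess}(S)=\{\mu\in\mathbb C : S-\mu I \text{ is not Fredholm}\}$ for the essential spectrum of $S\in\mathcal B(H)$. If $A_1$ and $A_2$ are $\mathcal{AN}$-operators with $\sigma_{ess}(A_1)=\sigma_{ess}(A_2)$ and $X$ has finite rank, then $T$ is an $\mathcal{AN}$-operator on $H_1\oplus H_2$. -/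

import Mathlib

/-- The essential spectrum of a bounded operator `T`: all `μ` such that `T - μ I` is not
Fredholm. -/
def essentialSpectrum {H : Type*} [NormedAddCommGroup H] [InnerProductSpace ℂ H]
    (T : H →L[ℂ] H) : Set ℂ :=
  {μ : ℂ | ¬ (T - μ • ContinuousLinearMap.id ℂ H).IsFredholm}

/-- On Hilbert spaces, Mathlib's Fredholm operators are those with closed range such that the
kernel of the operator and the kernel of its adjoint are finite dimensional. -/
theorem isFredholm_iff_closed_range_and_finite_kernels {H K : Type*}
    [NormedAddCommGroup H] [InnerProductSpace ℂ H] [CompleteSpace H]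
    [NormedAddCommGroup K] [InnerProductSpace ℂ K] [CompleteSpace K] (T : H →L[ℂ] K) :
    T.IsFredholm ↔ IsClosed (T.range : Set K) ∧ FiniteDimensional ℂ T.ker ∧
      FiniteDimensional ℂ (ContinuousLinearMap.adjoint T).ker := by
  have key : IsClosed (T.range : Set K) →
      (T.range.CoFG ↔ FiniteDimensional ℂ (ContinuousLinearMap.adjoint T).ker) := by
    intro hc
    have : CompleteSpace T.range := hc.completeSpace_coe
    rw [← ContinuousLinearMap.orthogonal_range]
    have e := Submodule.quotientEquivOfIsCompl T.range T.rangeᗮ T.range.isCompl_orthogonal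
    exact ⟨fun h => @Module.Finite.equiv _ _ _ _ _ _ _ _ h e,
      fun h => @Module.Finite.equiv _ _ _ _ _ _ _ _ h e.symm⟩
  constructor
  · intro h
    exact ⟨h.isClosed_range, h.finite_ker, (key h.isClosed_range).1 h.finite_coker⟩
  · rintro ⟨hc, hk, hk'⟩
    refine ⟨?_, hc, hk, (key hc).2 hk', ?_⟩
    · have : CompleteSpace T.range := hc.completeSpace_coe
      have hs : Function.Surjective (T.codRestrict T.range fun x => ⟨x, rfl⟩) := by
        rintro ⟨_, x, rfl⟩
        exact ⟨x, rfl⟩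
      have hq := (T.codRestrict T.range fun x => ⟨x, rfl⟩).isQuotientMap hs
      exact hq
    · exact Submodule.ClosedComplemented.of_finiteDimensional _

/-- A bounded operator `T` is norm attaining if `‖T x‖ = ‖T‖` for some unit vector `x`. -/
def IsNormAttaining {H K : Type*} [NormedAddCommGroup H] [InnerProductSpace ℂ H]
    [NormedAddCommGroup K] [InnerProductSpace ℂ K] (T : H →L[ℂ] K) : Prop :=
  ∃ x : H, ‖x‖ = 1 ∧ ‖T x‖ = ‖T‖

/-- A bounded operator is absolutely norm attaining (`AN`) if its restriction to every non-zero
closed subspace is norm attaining. -/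
def IsAbsolutelyNormAttaining {H K : Type*} [NormedAddCommGroup H] [InnerProductSpace ℂ H]
    [NormedAddCommGroup K] [InnerProductSpace ℂ K] (T : H →L[ℂ] K) : Prop :=
  ∀ M : Submodule ℂ H, IsClosed (M : Set H) → M ≠ ⊥ → IsNormAttaining (T ∘L M.subtypeL)

/-- A bounded operator has finite rank if its range is finite dimensional. -/
def IsFiniteRank {H K : Type*} [NormedAddCommGroup H] [InnerProductSpace ℂ H]
    [NormedAddCommGroup K] [InnerProductSpace ℂ K] (T : H →L[ℂ] K) : Prop :=
  FiniteDimensional ℂ T.range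

/-- The operator with block matrix `[[A, B], [C, D]]` on the Hilbert space direct sum
`H₁ ⊕ H₂`, that is, `(x, y) ↦ (A x + B y, C x + D y)`. -/
noncomputable def blockOperator {H₁ H₂ : Type*} [NormedAddCommGroup H₁] [InnerProductSpace ℂ H₁]
    [NormedAddCommGroup H₂] [InnerProductSpace ℂ H₂]
    (A : H₁ →L[ℂ] H₁) (B : H₂ →L[ℂ] H₁) (C : H₁ →L[ℂ] H₂) (D : H₂ →L[ℂ] H₂) :
    WithLp 2 (H₁ × H₂) →L[ℂ] WithLp 2 (H₁ × H₂) :=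
  (WithLp.prodContinuousLinearEquiv 2 ℂ H₁ H₂).symm.toContinuousLinearMap ∘L
    ((A.coprod B).prod (C.coprod D)) ∘L
      (WithLp.prodContinuousLinearEquiv 2 ℂ H₁ H₂).toContinuousLinearMap

theorem blockOperator_apply {H₁ H₂ : Type*} [NormedAddCommGroup H₁] [InnerProductSpace ℂ H₁]
    [NormedAddCommGroup H₂] [InnerProductSpace ℂ H₂]
    (A : H₁ →L[ℂ] H₁) (B : H₂ →L[ℂ] H₁) (C : H₁ →L[ℂ] H₂) (D : H₂ →L[ℂ] H₂) (x : H₁) (y : H₂) :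
    blockOperator A B C D (WithLp.toLp 2 (x, y)) = WithLp.toLp 2 (A x + B y, C x + D y) := by
  simp [blockOperator]

open scoped InnerProductSpace

/-! For an operator on an infinite-dimensional Hilbert space, being absolutely norm attaining forces
`‖A x‖²` to have an essential value `c` (`HasEssentialNormSq`): at most `(c + ε)‖x‖²` and at least
`c‖x‖²` on suitable subspaces of finite codimension. If the lower bound failed, vectors with values
rising strictly to `c` would span a closed subspace where the norm is not attained
(`exists_hasEssentialNormSq`). Conversely, an essential value passes to every subspace and makes the
norm attained there (`isAbsolutelyNormAttaining`).

For positive `A`, `√c` is the least nonnegative point of the essential spectrum, so equal essential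
spectra give `A₁` and `A₂` the same `c`. On `ker X† ⊕ ker X`, of finite codimension, `T` is block
diagonal and inherits `c`. -/

theorem Submodule.CoFG.comap_linearMap {V W : Type*} [AddCommGroup V] [Module ℂ V]
    [AddCommGroup W] [Module ℂ W] {M : Submodule ℂ W} (hM : M.CoFG) (f : V →ₗ[ℂ] W) :
    (M.comap f).CoFG := by
  rw [← Submodule.ker_mkQ M, ← LinearMap.ker_comp]
  exact .ker _

/-! ### Boundedness below on finite codimension and the Fredholm property -/

/-- An operator is bounded below on some subspace of finite codimension. -/
def IsBoundedBelowOnCoFG {H K : Type*} [NormedAddCommGroup H] [InnerProductSpace ℂ H]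
    [NormedAddCommGroup K] [InnerProductSpace ℂ K] (T : H →L[ℂ] K) : Prop :=
  ∃ δ > 0, ∃ M : Submodule ℂ H, M.CoFG ∧ ∀ x ∈ M, δ * ‖x‖ ≤ ‖T x‖

namespace IsBoundedBelowOnCoFG

variable {H K : Type*} [NormedAddCommGroup H] [InnerProductSpace ℂ H]
  [NormedAddCommGroup K] [InnerProductSpace ℂ K] {T : H →L[ℂ] K}

theorem finiteDimensional_ker (hT : IsBoundedBelowOnCoFG T) : FiniteDimensional ℂ T.ker := by
  obtain ⟨δ, hδ, M, hM, h⟩ := hT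
  refine .of_fg (Submodule.CoFG.fg_of_disjoint (T := M) ?_ hM)
  rw [Submodule.disjoint_def]
  intro x hx hxM
  have hx0 : T x = 0 := hx
  have := h x hxM
  rw [hx0, norm_zero] at this
  exact norm_eq_zero.1 (le_antisymm (by nlinarith [norm_nonneg x]) (norm_nonneg x))

theorem isClosed_range [CompleteSpace H] (hT : IsBoundedBelowOnCoFG T) :
    IsClosed (T.range : Set K) := by
  obtain ⟨δ, hδ, M, hM, h⟩ := hT
  have hcl : ∀ x ∈ M.topologicalClosure, δ * ‖x‖ ≤ ‖T x‖ := by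
    intro x hx
    have hc : IsClosed {x : H | δ * ‖x‖ ≤ ‖T x‖} :=
      isClosed_le (by fun_prop) (by fun_prop)
    exact closure_minimal (s := (M : Set H)) h hc hx
  -- It suffices that the image of the closed subspace `M.topologicalClosure` is closed: the rest of
  -- the range adds only finitely many dimensions.
  have hcofg : M.topologicalClosure.CoFG := hM.of_le M.le_topologicalClosure
  refine LinearMap.isClosed_range_of_isClosed_map_of_finiteDimensional_quotient
    (s := M.topologicalClosure) (f := (T : H →ₗ[ℂ] K)) ?_
  have hcomp : CompleteSpace M.topologicalClosure :=
    M.isClosed_topologicalClosure.completeSpace_coe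
  have hanti : AntilipschitzWith (Real.toNNReal δ⁻¹) (T ∘L M.topologicalClosure.subtypeL) := by
    refine ContinuousLinearMap.antilipschitz_of_bound _ fun x => ?_
    rw [Real.coe_toNNReal _ (by positivity), ← div_eq_inv_mul, le_div_iff₀ hδ, mul_comm]
    exact hcl x x.2
  have := hanti.isClosed_range (T ∘L M.topologicalClosure.subtypeL).uniformContinuous
  convert this using 1
  ext y
  simp only [Submodule.map_coe, Set.mem_image, Set.mem_range, Subtype.exists]
  exact ⟨fun ⟨x, hx, h⟩ => ⟨x, hx, h⟩, fun ⟨x, hx, h⟩ => ⟨x, hx, h⟩⟩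

theorem isFredholm [CompleteSpace H] {T : H →L[ℂ] H} (hT : IsBoundedBelowOnCoFG T)
    (hsa : IsSelfAdjoint T) : T.IsFredholm := by
  rw [isFredholm_iff_closed_range_and_finite_kernels, hsa.adjoint_eq]
  exact ⟨hT.isClosed_range, hT.finiteDimensional_ker, hT.finiteDimensional_ker⟩

theorem of_isFredholm [CompleteSpace H] [CompleteSpace K] (hT : T.IsFredholm) :
    IsBoundedBelowOnCoFG T := by
  have := hT.finite_ker
  have hcompl : IsCompl T.ker T.kerᗮ := T.ker.isCompl_orthogonal
  have hinj : Function.Injective (T ∘L T.kerᗮ.subtypeL) := by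
    rw [injective_iff_map_eq_zero]
    intro x hx
    have : (x : H) ∈ T.ker ⊓ T.kerᗮ := ⟨hx, x.2⟩
    rw [hcompl.inf_eq_bot] at this
    exact Subtype.ext this
  have hrange : Set.range (T ∘L T.kerᗮ.subtypeL) = T.range := by
    ext y
    constructor
    · rintro ⟨x, rfl⟩
      exact ⟨x, rfl⟩
    · rintro ⟨x, rfl⟩
      obtain ⟨a, ha, b, hb, rfl⟩ :=
        Submodule.mem_sup.1 (hcompl.sup_eq_top ▸ Submodule.mem_top : x ∈ T.ker ⊔ T.kerᗮ)
      refine ⟨⟨b, hb⟩, ?_⟩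
      have ha0 : T a = 0 := ha
      simp [ha0]
  obtain ⟨C, hC⟩ := ContinuousLinearMap.antilipschitz_of_injective_of_isClosed_range
    (T ∘L T.kerᗮ.subtypeL) hinj (hrange ▸ hT.isClosed_range)
  -- The constant `C` may be zero, so `C + 1` is inverted instead.
  refine ⟨(C + 1 : ℝ)⁻¹, by positivity, T.kerᗮ,
    Submodule.FG.cofg_of_isCompl hcompl (Module.Finite.iff_fg.1 this), fun x hx => ?_⟩
  have := ContinuousLinearMap.bound_of_antilipschitz _ hC ⟨x, hx⟩
  rw [← div_eq_inv_mul, div_le_iff₀ (by positivity)]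
  have h2 : ‖x‖ ≤ C * ‖T x‖ := this
  nlinarith [norm_nonneg (T x)]

end IsBoundedBelowOnCoFG

/-! ### From an essential value to absolute norm attainment -/

/-- `c` is the essential value of the quadratic form `‖A x‖²`: up to arbitrarily small errors,
`‖A x‖² = c ‖x‖²` on subspaces of finite codimension, and `c ‖x‖²` is a lower bound on one of
them. -/
structure HasEssentialNormSq {H K : Type*} [NormedAddCommGroup H] [InnerProductSpace ℂ H]
    [NormedAddCommGroup K] [InnerProductSpace ℂ K] (A : H →L[ℂ] K) (c : ℝ) : Prop where
  upper : ∀ ε > 0, ∃ M : Submodule ℂ H, M.CoFG ∧ ∀ x ∈ M, ‖A x‖ ^ 2 ≤ (c + ε) * ‖x‖ ^ 2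
  lower : ∃ M : Submodule ℂ H, M.CoFG ∧ ∀ x ∈ M, c * ‖x‖ ^ 2 ≤ ‖A x‖ ^ 2

theorem ContinuousLinearMap.re_inner_adjoint_apply {H K : Type*} [NormedAddCommGroup H]
    [InnerProductSpace ℂ H] [CompleteSpace H] [NormedAddCommGroup K] [InnerProductSpace ℂ K]
    [CompleteSpace K] (S : H →L[ℂ] K) (x : H) :
    (⟪S.adjoint (S x), x⟫_ℂ).re = ‖S x‖ ^ 2 := by
  rw [ContinuousLinearMap.adjoint_inner_left, inner_self_eq_norm_sq_to_K]
  norm_cast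

/-- Expand the square and use `‖S†S x‖ ≤ ‖S‖ ‖S x‖`. Near-maximizers of `‖S x‖` are thus
near-eigenvectors of `S†S`. -/
theorem norm_sub_adjoint_apply_sq_le {H K : Type*} [NormedAddCommGroup H]
    [InnerProductSpace ℂ H] [CompleteSpace H] [NormedAddCommGroup K] [InnerProductSpace ℂ K]
    [CompleteSpace K] (S : H →L[ℂ] K) (x : H) :
    ‖((‖S‖ ^ 2 : ℝ) : ℂ) • x - S.adjoint (S x)‖ ^ 2 ≤
      ‖S‖ ^ 2 * (‖S‖ ^ 2 * ‖x‖ ^ 2 - ‖S x‖ ^ 2) := by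
  have h1 : ‖S.adjoint (S x)‖ ≤ ‖S‖ * ‖S x‖ := by
    simpa using S.adjoint.le_opNorm (S x)
  have h2 : ‖S.adjoint (S x)‖ ^ 2 ≤ ‖S‖ ^ 2 * ‖S x‖ ^ 2 := by
    rw [← mul_pow]; gcongr
  have h3 := norm_sub_sq (𝕜 := ℂ) (((‖S‖ ^ 2 : ℝ) : ℂ) • x) (S.adjoint (S x))
  have h4 : RCLike.re ⟪((‖S‖ ^ 2 : ℝ) : ℂ) • x, S.adjoint (S x)⟫_ℂ = ‖S‖ ^ 2 * ‖S x‖ ^ 2 := by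
    rw [inner_smul_left, ← S.re_inner_adjoint_apply x, ← inner_conj_symm, Complex.conj_ofReal]
    exact (Complex.re_ofReal_mul _ _).trans (by rw [Complex.conj_re])
  rw [h3, h4, norm_smul, Complex.norm_real, Real.norm_eq_abs, abs_of_nonneg (by positivity)]
  nlinarith

theorem adjoint_apply_eq_of_norm_eq {H K : Type*} [NormedAddCommGroup H]
    [InnerProductSpace ℂ H] [CompleteSpace H] [NormedAddCommGroup K] [InnerProductSpace ℂ K]
    [CompleteSpace K] {S : H →L[ℂ] K} {x : H} (hx : ‖x‖ = 1) (h : ‖S x‖ = ‖S‖) :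
    S.adjoint (S x) = ((‖S‖ ^ 2 : ℝ) : ℂ) • x := by
  have := norm_sub_adjoint_apply_sq_le S x
  rw [h, hx] at this
  have h0 : ‖((‖S‖ ^ 2 : ℝ) : ℂ) • x - S.adjoint (S x)‖ ^ 2 = 0 :=
    le_antisymm (by linarith) (by positivity)
  exact (sub_eq_zero.1 (norm_eq_zero.1 (pow_eq_zero_iff two_ne_zero |>.1 h0))).symm

/-- If `‖S‖² - S†S` is bounded below on a subspace of finite codimension, then `S` attains its
norm. -/
theorem IsBoundedBelowOnCoFG.isNormAttaining {H K : Type*} [NormedAddCommGroup H]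
    [InnerProductSpace ℂ H] [CompleteSpace H] [NormedAddCommGroup K] [InnerProductSpace ℂ K]
    [CompleteSpace K] {S : H →L[ℂ] K} (hS : S ≠ 0)
    (hD : IsBoundedBelowOnCoFG
      (((‖S‖ ^ 2 : ℝ) : ℂ) • ContinuousLinearMap.id ℂ H - S.adjoint ∘L S)) :
    IsNormAttaining S := by
  have hpos : 0 < ‖S‖ := norm_pos_iff.2 hS
  set D := ((‖S‖ ^ 2 : ℝ) : ℂ) • ContinuousLinearMap.id ℂ H - S.adjoint ∘L S with hDdef
  have hDx : ∀ x, D x = ((‖S‖ ^ 2 : ℝ) : ℂ) • x - S.adjoint (S x) := fun x => rfl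
  -- If `D` were injective, its closed range would make it bounded below everywhere, pushing `‖S x‖`
  -- uniformly below `‖S‖ ‖x‖`. Otherwise any nonzero kernel vector, normalized, attains the norm.
  by_cases hinj : Function.Injective D
  · exfalso
    obtain ⟨C, hC⟩ := D.antilipschitz_of_injective_of_isClosed_range hinj hD.isClosed_range
    set d : ℝ := ((C : ℝ) + 1)⁻¹
    have hd : 0 < d := by positivity
    have hb : ∀ x, d ^ 2 * ‖x‖ ^ 2 ≤ ‖D x‖ ^ 2 := by
      intro x
      rw [← mul_pow]
      gcongr
      rw [← div_eq_inv_mul, div_le_iff₀ (by positivity)]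
      nlinarith [D.bound_of_antilipschitz hC x, norm_nonneg (D x)]
    have hb2 : ∀ x, ‖S x‖ ^ 2 ≤ (‖S‖ ^ 2 - d ^ 2 / ‖S‖ ^ 2) * ‖x‖ ^ 2 := by
      intro x
      have h1 := (hb x).trans ((hDx x ▸ norm_sub_adjoint_apply_sq_le S x))
      have h2 : d ^ 2 / ‖S‖ ^ 2 * ‖x‖ ^ 2 ≤ ‖S‖ ^ 2 * ‖x‖ ^ 2 - ‖S x‖ ^ 2 := by
        rw [div_mul_eq_mul_div, div_le_iff₀ (by positivity)]
        linarith
      linarith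
    have hb3 : ‖S‖ ≤ √(‖S‖ ^ 2 - d ^ 2 / ‖S‖ ^ 2) := by
      refine S.opNorm_le_bound (Real.sqrt_nonneg _) fun x => ?_
      rw [← Real.sqrt_sq (norm_nonneg x), ← Real.sqrt_mul' _ (by positivity)]
      exact Real.le_sqrt_of_sq_le (hb2 x)
    have h5 : 0 < d ^ 2 / ‖S‖ ^ 2 := by positivity
    have := hb3.trans_lt ((Real.sqrt_lt' hpos).2 (by linarith : _ < ‖S‖ ^ 2))
    exact lt_irrefl _ this
  · rw [injective_iff_map_eq_zero] at hinj
    push Not at hinj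
    obtain ⟨x, hx, hx0⟩ := hinj
    have hxn : ‖x‖ ≠ 0 := norm_ne_zero_iff.2 hx0
    have h1 : ‖S x‖ ^ 2 = (‖S‖ * ‖x‖) ^ 2 := by
      rw [← S.re_inner_adjoint_apply x, ← sub_eq_zero.1 ((hDx x).symm.trans hx), inner_smul_left,
        Complex.conj_ofReal, Complex.re_ofReal_mul, inner_self_eq_norm_sq_to_K, mul_pow]
      norm_cast
    have h2 : ‖S x‖ = ‖S‖ * ‖x‖ := (sq_eq_sq₀ (by positivity) (by positivity)).1 h1
    refine ⟨((‖x‖⁻¹ : ℝ) : ℂ) • x, ?_, ?_⟩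
    · rw [norm_smul]; simp [hxn]
    · rw [map_smul, norm_smul, h2]; simp; field_simp

namespace HasEssentialNormSq

variable {H K : Type*} [NormedAddCommGroup H] [InnerProductSpace ℂ H]
  [NormedAddCommGroup K] [InnerProductSpace ℂ K] {A : H →L[ℂ] K} {c : ℝ}

theorem restrict (hA : HasEssentialNormSq A c) (N : Submodule ℂ H) :
    HasEssentialNormSq (A ∘L N.subtypeL) c := by
  refine ⟨fun ε hε => ?_, ?_⟩
  · obtain ⟨M, hM, h⟩ := hA.upper ε hε
    exact ⟨M.comap N.subtype, hM.comap_linearMap _, fun x hx => h x hx⟩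
  · obtain ⟨M, hM, h⟩ := hA.lower
    exact ⟨M.comap N.subtype, hM.comap_linearMap _, fun x hx => h x hx⟩

theorem isNormAttaining [CompleteSpace H] [CompleteSpace K] [Nontrivial H]
    (hA : HasEssentialNormSq A c) : IsNormAttaining A := by
  rcases eq_or_ne A 0 with rfl | hA0
  · obtain ⟨x, hx⟩ := exists_norm_eq H zero_le_one
    exact ⟨x, hx, by simp⟩
  obtain ⟨M, hM, hlow⟩ := hA.lower
  by_cases hc : c < ‖A‖ ^ 2
  · obtain ⟨M', hM', hup⟩ := hA.upper ((‖A‖ ^ 2 - c) / 2) (by linarith)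
    refine IsBoundedBelowOnCoFG.isNormAttaining hA0
      ⟨(‖A‖ ^ 2 - c) / 2, by linarith, M', hM', fun x hx => ?_⟩
    rcases (norm_nonneg x).eq_or_lt with h0 | h0
    · simp [← h0]
    have h1 := hup x hx
    have h2 := Complex.abs_re_le_norm ⟪((‖A‖ ^ 2 : ℝ) : ℂ) • x - A.adjoint (A x), x⟫_ℂ
    have h3 : (⟪((‖A‖ ^ 2 : ℝ) : ℂ) • x - A.adjoint (A x), x⟫_ℂ).re
        = ‖A‖ ^ 2 * ‖x‖ ^ 2 - ‖A x‖ ^ 2 := by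
      rw [inner_sub_left, Complex.sub_re, A.re_inner_adjoint_apply, inner_smul_left,
        Complex.conj_ofReal, Complex.re_ofReal_mul, inner_self_eq_norm_sq_to_K]
      norm_cast
    rw [h3] at h2
    have h4 := (le_abs_self _).trans (h2.trans (norm_inner_le_norm _ _))
    refine le_of_mul_le_mul_right ?_ h0
    refine le_trans ?_ h4
    nlinarith
  -- Now `‖A‖² ≤ c`, so every nonzero vector of `M` is a maximizer; if `M = ⊥`, the bound on finite
  -- codimension is vacuous.
  · by_cases hbot : M = ⊥
    · refine IsBoundedBelowOnCoFG.isNormAttaining hA0 ⟨1, one_pos, M, hM, fun x hx => ?_⟩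
      rw [hbot, Submodule.mem_bot] at hx
      simp [hx]
    · obtain ⟨x, hxM, hx0⟩ := M.ne_bot_iff.1 hbot
      have hxn : ‖x‖ ≠ 0 := norm_ne_zero_iff.2 hx0
      have hle : ‖A‖ * ‖x‖ ≤ ‖A x‖ := by
        refine (sq_le_sq₀ (by positivity) (by positivity)).1 ?_
        rw [mul_pow]
        exact (mul_le_mul_of_nonneg_right (not_lt.1 hc) (by positivity)).trans (hlow x hxM)
      have heq := le_antisymm (A.le_opNorm x) hle
      refine ⟨((‖x‖⁻¹ : ℝ) : ℂ) • x, ?_, ?_⟩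
      · rw [norm_smul]; simp [hxn]
      · rw [map_smul, norm_smul, heq]; simp; field_simp

theorem isAbsolutelyNormAttaining [CompleteSpace H] [CompleteSpace K]
    (hA : HasEssentialNormSq A c) : IsAbsolutelyNormAttaining A := by
  intro N hN hbot
  have := hN.completeSpace_coe
  have := Submodule.nontrivial_iff_ne_bot.2 hbot
  exact (hA.restrict N).isNormAttaining

end HasEssentialNormSq

/-! ### From absolute norm attainment to an essential value -/

/-- An absolutely norm attaining operator admits no orthonormal sequence whose images are pairwise
orthogonal and have strictly increasing norms. -/
theorem IsAbsolutelyNormAttaining.not_strictMono_norm {H K : Type*} [NormedAddCommGroup H]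
    [InnerProductSpace ℂ H] [CompleteSpace H] [NormedAddCommGroup K] [InnerProductSpace ℂ K]
    [CompleteSpace K] {A : H →L[ℂ] K} (hA : IsAbsolutelyNormAttaining A) (f : ℕ → H)
    (hf : Orthonormal ℂ f) (hAf : Pairwise fun m n => ⟪A (f m), A (f n)⟫_ℂ = 0) :
    ¬ StrictMono fun n => ‖A (f n)‖ := by
  intro hmono
  set N := (Submodule.span ℂ (Set.range f)).topologicalClosure with hN
  have hcl : IsClosed (N : Set H) := Submodule.isClosed_topologicalClosure _
  have : CompleteSpace N := hcl.completeSpace_coe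
  have hfN : ∀ n, f n ∈ N := fun n =>
    Submodule.le_topologicalClosure _ (Submodule.subset_span ⟨n, rfl⟩)
  have hbot : N ≠ ⊥ := fun h => hf.ne_zero 0 ((Submodule.mem_bot ℂ).1 (h ▸ hfN 0))
  obtain ⟨x, hx1, hx⟩ := hA N hcl hbot
  set S := A ∘L N.subtypeL with hS
  have hSx := adjoint_apply_eq_of_norm_eq hx1 hx
  have hext : ∀ v w : H, (∀ n, ⟪v, f n⟫_ℂ = ⟪w, f n⟫_ℂ) → ∀ y ∈ N, ⟪v, y⟫_ℂ = ⟪w, y⟫_ℂ := by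
    intro v w h y hy
    have hc : IsClosed {y : H | ⟪v, y⟫_ℂ = ⟪w, y⟫_ℂ} :=
      isClosed_eq (by fun_prop) (by fun_prop)
    refine closure_minimal (s := (Submodule.span ℂ (Set.range f) : Set H)) ?_ hc hy
    intro z hz
    induction hz using Submodule.span_induction with
    | mem z hz => obtain ⟨n, rfl⟩ := hz; exact h n
    | zero => simp
    | add a b _ _ ha hb =>
      simp only [Set.mem_ofPred_eq, inner_add_right] at ha hb ⊢
      rw [ha, hb]
    | smul a b _ hb =>
      simp only [Set.mem_ofPred_eq, inner_smul_right] at hb ⊢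
      rw [hb]
  -- The compression of `A†A` to `N` has eigenvector `f n` with eigenvalue `‖A (f n)‖² < ‖S‖²` and
  -- the maximizer `x` with eigenvalue `‖S‖²`; distinct eigenvalues force orthogonality.
  have hcoef : ∀ n, ⟪f n, (x : H)⟫_ℂ = 0 := by
    intro n
    have h1 : ⟪A.adjoint (A (f n)), (x : H)⟫_ℂ =
        ⟪((‖A (f n)‖ ^ 2 : ℝ) : ℂ) • f n, (x : H)⟫_ℂ := by
      refine hext _ _ (fun m => ?_) x x.2
      rw [ContinuousLinearMap.adjoint_inner_left, inner_smul_left, Complex.conj_ofReal]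
      rcases eq_or_ne n m with rfl | hnm
      · rw [inner_self_eq_norm_sq_to_K, inner_self_eq_norm_sq_to_K, hf.1 n]
        simp
      · rw [hAf hnm, hf.2 hnm, mul_zero]
    have h2 : ⟪(⟨f n, hfN n⟩ : N), S.adjoint (S x)⟫_ℂ =
        ((‖S‖ ^ 2 : ℝ) : ℂ) * ⟪f n, (x : H)⟫_ℂ := by
      rw [hSx, inner_smul_right]
      rfl
    rw [ContinuousLinearMap.adjoint_inner_right] at h2
    have h3 : ⟪A (f n), A x⟫_ℂ = ((‖S‖ ^ 2 : ℝ) : ℂ) * ⟪f n, (x : H)⟫_ℂ := h2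
    rw [ContinuousLinearMap.adjoint_inner_left, inner_smul_left, Complex.conj_ofReal, h3] at h1
    have hlt : ‖A (f n)‖ < ‖S‖ := by
      refine (hmono (Nat.lt_succ_self n)).trans_le ?_
      have := S.le_opNorm ⟨f (n + 1), hfN _⟩
      have hn : ‖(⟨f (n + 1), hfN _⟩ : N)‖ = 1 := hf.1 _
      rw [hn, mul_one] at this
      exact this
    have hlt2 : ‖A (f n)‖ ^ 2 < ‖S‖ ^ 2 := by gcongr
    by_contra hne
    have := Complex.ofReal_injective (mul_right_cancel₀ hne h1)
    exact hlt2.ne' this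
  have hx0 : ⟪(x : H), (x : H)⟫_ℂ = ⟪(0 : H), (x : H)⟫_ℂ :=
    hext x 0 (fun n => by rw [← inner_conj_symm, hcoef n]; simp) x x.2
  rw [inner_zero_left, inner_self_eq_zero] at hx0
  have : ‖(x : H)‖ = 1 := hx1
  rw [hx0, norm_zero] at this
  exact zero_ne_one this

theorem Submodule.CoFG.ker_innerSL {H : Type*} [NormedAddCommGroup H] [InnerProductSpace ℂ H]
    (v : H) : (innerSL ℂ v).ker.CoFG :=
  .ker _

/-- For an absolutely norm attaining operator `A`, the values of `‖A x‖²` at unit vectors of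
arbitrary subspaces of finite codimension cannot approach any `u` strictly from below. -/
theorem IsAbsolutelyNormAttaining.false_of_forall_exists_unit {H K : Type*}
    [NormedAddCommGroup H]
    [InnerProductSpace ℂ H] [CompleteSpace H] [NormedAddCommGroup K] [InnerProductSpace ℂ K]
    [CompleteSpace K] {A : H →L[ℂ] K} (hA : IsAbsolutelyNormAttaining A) (u : ℝ)
    (h : ∀ t < u, ∀ M : Submodule ℂ H, M.CoFG →
      ∃ x ∈ M, ‖x‖ = 1 ∧ t < ‖A x‖ ^ 2 ∧ ‖A x‖ ^ 2 < u) : False := by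
  obtain ⟨f, hf1, hf2⟩ := exists_seq_of_forall_finset_exists
    (fun x : H => ‖x‖ = 1 ∧ ‖A x‖ ^ 2 < u)
    (fun x y => ⟪x, y⟫_ℂ = 0 ∧ ⟪A x, A y⟫_ℂ = 0 ∧ ‖A x‖ < ‖A y‖) (by
      intro s hs
      have ht : ∃ t < u, ∀ x ∈ s, ‖A x‖ ^ 2 ≤ t := by
        classical
        induction s using Finset.induction with
        | empty => exact ⟨u - 1, by linarith, by simp⟩
        | insert a s _ ih =>
          obtain ⟨t, htu, ht⟩ := ih fun x hx => hs x (Finset.mem_insert_of_mem hx)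
          refine ⟨max t (‖A a‖ ^ 2), max_lt htu (hs a (Finset.mem_insert_self _ _)).2, ?_⟩
          intro x hx
          rcases Finset.mem_insert.1 hx with rfl | hx
          · exact le_max_right _ _
          · exact (ht x hx).trans (le_max_left _ _)
      obtain ⟨t, htu, ht⟩ := ht
      -- Orthogonality to each earlier `x` and to `A†A x` is finitely many linear conditions; the
      -- latter makes the images orthogonal.
      obtain ⟨y, hyM, hy1, hty, hyu⟩ := h t htu
        (sInf ((fun x => (innerSL ℂ x).ker ⊓ (innerSL ℂ (A.adjoint (A x))).ker) '' (s : Set H)))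
        (Submodule.CoFG.sInf_of_finite (s.finite_toSet.image _) (by
          rintro _ ⟨x, -, rfl⟩
          exact .inf (.ker_innerSL _) (.ker_innerSL _)))
      refine ⟨y, ⟨hy1, hyu⟩, fun x hx => ?_⟩
      have hxy := Submodule.mem_sInf.1 hyM _ ⟨x, hx, rfl⟩
      refine ⟨hxy.1, ?_, ?_⟩
      · have h2 : ⟪A.adjoint (A x), y⟫_ℂ = 0 := hxy.2
        rwa [ContinuousLinearMap.adjoint_inner_left] at h2
      · exact lt_of_pow_lt_pow_left₀ 2 (norm_nonneg _) ((ht x hx).trans_lt hty))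
  refine hA.not_strictMono_norm f ⟨fun n => (hf1 n).1, ?_⟩ ?_ ?_
  · intro m n hmn
    rcases hmn.lt_or_gt with hlt | hlt
    · exact (hf2 m n hlt).1
    · rw [← inner_conj_symm, (hf2 n m hlt).1, map_zero]
  · intro m n hmn
    rcases hmn.lt_or_gt with hlt | hlt
    · exact (hf2 m n hlt).2.1
    · rw [← inner_conj_symm, (hf2 n m hlt).2.1, map_zero]
  · exact strictMono_nat_of_lt_succ fun n => (hf2 n (n + 1) n.lt_succ_self).2.2

theorem exists_unit_smul_mem {H K : Type*} [NormedAddCommGroup H]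
    [InnerProductSpace ℂ H] [NormedAddCommGroup K] [InnerProductSpace ℂ K] (A : H →L[ℂ] K)
    {M : Submodule ℂ H} {x : H} (hx : x ∈ M) (hx0 : x ≠ 0) :
    ∃ y ∈ M, ‖y‖ = 1 ∧ ‖A x‖ ^ 2 = ‖A y‖ ^ 2 * ‖x‖ ^ 2 := by
  have hxn : ‖x‖ ≠ 0 := norm_ne_zero_iff.2 hx0
  refine ⟨((‖x‖⁻¹ : ℝ) : ℂ) • x, M.smul_mem _ hx, ?_, ?_⟩
  · rw [norm_smul]; simp [hxn]
  · rw [map_smul, norm_smul]; simp; field_simp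

/-- Intermediate value theorem for the quadratic form `‖A x‖²` on unit vectors. -/
theorem exists_unit_norm_sq_eq {H K : Type*} [NormedAddCommGroup H]
    [InnerProductSpace ℂ H] [NormedAddCommGroup K] [InnerProductSpace ℂ K] (A : H →L[ℂ] K)
    {M : Submodule ℂ H} {t : ℝ} {x y : H} (hx : x ∈ M) (hy : y ∈ M)
    (hxt : ‖A x‖ ^ 2 < t * ‖x‖ ^ 2) (hyt : t * ‖y‖ ^ 2 < ‖A y‖ ^ 2) :
    ∃ z ∈ M, ‖z‖ = 1 ∧ ‖A z‖ ^ 2 = t := by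
  let p : ℝ → H := fun s => ((1 - s : ℝ) : ℂ) • x + (s : ℂ) • y
  let g : ℝ → ℝ := fun s => ‖A (p s)‖ ^ 2 - t * ‖p s‖ ^ 2
  have hg : Continuous g := by fun_prop
  have h0 : g 0 ≤ 0 := by simp only [g, p]; simp; linarith
  have h1 : 0 ≤ g 1 := by simp only [g, p]; simp; linarith
  obtain ⟨s, -, hs⟩ := intermediate_value_Icc zero_le_one hg.continuousOn ⟨h0, h1⟩
  -- A segment through `0` would make `x` and `y` satisfy a linear relation incompatible with their
  -- values of `‖A ·‖² - t‖·‖²` having opposite strict signs.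
  have hps : p s ≠ 0 := by
    intro h
    have hxy : ((1 - s : ℝ) : ℂ) • x = -((s : ℂ) • y) := eq_neg_of_add_eq_zero_left h
    have e1 : |1 - s| * ‖x‖ = |s| * ‖y‖ := by
      have := congrArg norm hxy
      rwa [norm_neg, norm_smul, norm_smul, Complex.norm_real, Complex.norm_real] at this
    have e2 : |1 - s| * ‖A x‖ = |s| * ‖A y‖ := by
      have := congrArg (fun v => ‖A v‖) hxy
      simpa only [map_neg, map_smul, norm_neg, norm_smul, Complex.norm_real,
        Real.norm_eq_abs] using this
    have e3 : (1 - s) ^ 2 * ‖x‖ ^ 2 = s ^ 2 * ‖y‖ ^ 2 := by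
      rw [← sq_abs (1 - s), ← sq_abs s, ← mul_pow, ← mul_pow, e1]
    have e4 : (1 - s) ^ 2 * ‖A x‖ ^ 2 = s ^ 2 * ‖A y‖ ^ 2 := by
      rw [← sq_abs (1 - s), ← sq_abs s, ← mul_pow, ← mul_pow, e2]
    have e5 : (1 - s) ^ 2 * (t * ‖x‖ ^ 2 - ‖A x‖ ^ 2) + s ^ 2 * (‖A y‖ ^ 2 - t * ‖y‖ ^ 2) = 0 := by
      linear_combination t * e3 - e4
    have n1 := mul_nonneg (sq_nonneg (1 - s)) (sub_pos.2 hxt).le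
    have n2 := mul_nonneg (sq_nonneg s) (sub_pos.2 hyt).le
    have z1 : (1 - s) ^ 2 = 0 :=
      (mul_eq_zero.1 (by linarith)).resolve_right (sub_pos.2 hxt).ne'
    have z2 : s ^ 2 = 0 :=
      (mul_eq_zero.1 (by linarith)).resolve_right (sub_pos.2 hyt).ne'
    nlinarith
  have hpM : p s ∈ M := M.add_mem (M.smul_mem _ hx) (M.smul_mem _ hy)
  obtain ⟨z, hz, hz1, hzA⟩ := exists_unit_smul_mem A hpM hps
  refine ⟨z, hz, hz1, ?_⟩
  have hgs : ‖A (p s)‖ ^ 2 - t * ‖p s‖ ^ 2 = 0 := hs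
  have hn : ‖p s‖ ^ 2 ≠ 0 := pow_ne_zero _ (norm_ne_zero_iff.2 hps)
  exact mul_right_cancel₀ hn (by linarith)

theorem Submodule.CoFG.exists_mem_ne_zero {V : Type*} [AddCommGroup V] [Module ℂ V]
    (hV : ¬ FiniteDimensional ℂ V) {M : Submodule ℂ V} (hM : M.CoFG) : ∃ x ∈ M, x ≠ 0 :=
  M.ne_bot_iff.1 fun h => hV ((Module.Finite.iff_cofg_bot _ _).1 (h ▸ hM))

/-- An absolutely norm attaining operator on an infinite-dimensional Hilbert space has an essential
value of `‖A x‖²`. -/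
theorem IsAbsolutelyNormAttaining.exists_hasEssentialNormSq {H K : Type*} [NormedAddCommGroup H]
    [InnerProductSpace ℂ H] [CompleteSpace H] [NormedAddCommGroup K] [InnerProductSpace ℂ K]
    [CompleteSpace K] {A : H →L[ℂ] K} (hA : IsAbsolutelyNormAttaining A)
    (hH : ¬ FiniteDimensional ℂ H) : ∃ c, 0 ≤ c ∧ HasEssentialNormSq A c := by
  let G : Set ℝ := {t | ∃ M : Submodule ℂ H, M.CoFG ∧ ∀ x ∈ M, ‖A x‖ ^ 2 ≤ t * ‖x‖ ^ 2}
  have hG0 : ∀ t ∈ G, 0 ≤ t := by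
    rintro t ⟨M, hM, h⟩
    obtain ⟨x, hx, hx0⟩ := hM.exists_mem_ne_zero hH
    have : 0 < ‖x‖ := norm_pos_iff.2 hx0
    exact nonneg_of_mul_nonneg_left ((sq_nonneg _).trans (h x hx)) (by positivity)
  have hGne : G.Nonempty := ⟨‖A‖ ^ 2, ⊤, .top, fun x _ => by
    rw [← mul_pow]; gcongr; exact A.le_opNorm x⟩
  have hGbdd : BddBelow G := ⟨0, hG0⟩
  set c := sInf G
  have hup : ∀ ε > 0, ∃ M : Submodule ℂ H, M.CoFG ∧ ∀ x ∈ M, ‖A x‖ ^ 2 ≤ (c + ε) * ‖x‖ ^ 2 := by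
    intro ε hε
    obtain ⟨t, ⟨M, hM, h⟩, ht⟩ := exists_lt_of_csInf_lt hGne (lt_add_of_pos_right c hε)
    exact ⟨M, hM, fun x hx => (h x hx).trans (by gcongr)⟩
  have hlow : ∀ a < c, ∃ M : Submodule ℂ H, M.CoFG ∧ ∀ x ∈ M, a * ‖x‖ ^ 2 ≤ ‖A x‖ ^ 2 := by
    intro a ha
    by_contra! hcon
    refine hA.false_of_forall_exists_unit c fun t ht M hM => ?_
    -- Values below `a < r` occur by `hcon`, values above `r` because `r < sInf G`; the intermediate
    -- value theorem yields `r` itself.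
    obtain ⟨r, hr, hrc⟩ := exists_between (max_lt ha ht)
    have hrG : r ∉ G := notMem_of_lt_csInf hrc hGbdd
    obtain ⟨x, hx, hxa⟩ := hcon M hM
    have : ∃ y ∈ M, r * ‖y‖ ^ 2 < ‖A y‖ ^ 2 := by
      by_contra! h
      exact hrG ⟨M, hM, h⟩
    obtain ⟨y, hy, hyr⟩ := this
    have hxr : ‖A x‖ ^ 2 < r * ‖x‖ ^ 2 :=
      hxa.trans_le (mul_le_mul_of_nonneg_right ((le_max_left _ _).trans hr.le) (by positivity))
    obtain ⟨z, hz, hz1, hzr⟩ := exists_unit_norm_sq_eq A hx hy hxr hyr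
    exact ⟨z, hz, hz1, hzr ▸ (le_max_right _ _).trans_lt hr, hzr ▸ hrc⟩
  refine ⟨c, le_csInf hGne hG0, hup, ?_⟩
  -- Bounds `r < c` are now available on finite codimension, so failure of the bound `c` produces
  -- unit vectors with values in `[r, c)`.
  by_contra! hcon
  refine hA.false_of_forall_exists_unit c fun t ht M hM => ?_
  obtain ⟨r, htr, hrc⟩ := exists_between ht
  obtain ⟨M', hM', h'⟩ := hlow r hrc
  obtain ⟨x, hx, hxc⟩ := hcon (M ⊓ M') (hM.inf hM')
  have hx0 : x ≠ 0 := by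
    rintro rfl
    simp at hxc
  obtain ⟨y, hy, hy1, hxy⟩ := exists_unit_smul_mem A hx hx0
  refine ⟨y, hy.1, hy1, ?_, ?_⟩
  · have := h' y hy.2
    rw [hy1] at this
    linarith
  · rw [hxy] at hxc
    exact lt_of_mul_lt_mul_right hxc (by positivity)

/-! ### The essential value and the essential spectrum -/

namespace HasEssentialNormSq

variable {H : Type*} [NormedAddCommGroup H] [InnerProductSpace ℂ H] [CompleteSpace H]
  {A : H →L[ℂ] H} {c : ℝ}

/-- Polarize `q v = ‖A v‖² - c‖v‖²` with `z = A†A x - c x`: the upper bound at `εx + z` and `q ≥ 0`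
at `εx - z` give `4‖z‖² ≤ ‖εx + z‖²`, hence `‖z‖ ≤ ε‖x‖`. -/
theorem exists_norm_adjoint_sub_le {K : Type*} [NormedAddCommGroup K] [InnerProductSpace ℂ K]
    [CompleteSpace K] {A : H →L[ℂ] K} (hA : HasEssentialNormSq A c) {ε : ℝ} (hε : 0 < ε) :
    ∃ M : Submodule ℂ H, M.CoFG ∧
      ∀ x ∈ M, ‖A.adjoint (A x) - (c : ℂ) • x‖ ≤ ε * ‖x‖ := by
  obtain ⟨M₁, hM₁, h₁⟩ := hA.upper ε hε
  obtain ⟨M₂, hM₂, h₂⟩ := hA.lower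
  set C : H →L[ℂ] H := A.adjoint ∘L A - (c : ℂ) • ContinuousLinearMap.id ℂ H with hC
  have hCx : ∀ x, C x = A.adjoint (A x) - (c : ℂ) • x := fun x => rfl
  refine ⟨(M₁ ⊓ M₂) ⊓ (M₁ ⊓ M₂).comap (C : H →ₗ[ℂ] H),
    (hM₁.inf hM₂).inf ((hM₁.inf hM₂).comap_linearMap _), fun x hx => ?_⟩
  rw [← hCx]
  have hxM : x ∈ M₁ ⊓ M₂ := hx.1
  have hz : C x ∈ M₁ ⊓ M₂ := hx.2
  set z := C x with hzdef
  have hεx : (ε : ℂ) • x ∈ M₁ ⊓ M₂ := Submodule.smul_mem _ _ hxM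
  have hu := h₁ _ (Submodule.add_mem _ hεx hz).1
  have hl := h₂ _ (Submodule.sub_mem _ hεx hz).2
  have hinner : (⟪A x, A z⟫_ℂ).re = ‖z‖ ^ 2 + c * (⟪x, z⟫_ℂ).re := by
    rw [← ContinuousLinearMap.adjoint_inner_left,
      show A.adjoint (A x) = z + (c : ℂ) • x by rw [hzdef, hCx]; abel,
      inner_add_left, inner_smul_left, Complex.conj_ofReal, Complex.add_re, Complex.re_ofReal_mul,
      inner_self_eq_norm_sq_to_K]
    norm_cast
  have e1 := norm_add_sq (𝕜 := ℂ) (A ((ε : ℂ) • x)) (A z)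
  have e2 := norm_sub_sq (𝕜 := ℂ) (A ((ε : ℂ) • x)) (A z)
  have e3 := norm_add_sq (𝕜 := ℂ) ((ε : ℂ) • x) z
  have e4 := norm_sub_sq (𝕜 := ℂ) ((ε : ℂ) • x) z
  have e5 : RCLike.re ⟪A ((ε : ℂ) • x), A z⟫_ℂ = ε * (‖z‖ ^ 2 + c * (⟪x, z⟫_ℂ).re) := by
    rw [map_smul, inner_smul_left, Complex.conj_ofReal, ← hinner]
    exact Complex.re_ofReal_mul _ _
  have e6 : RCLike.re ⟪(ε : ℂ) • x, z⟫_ℂ = ε * (⟪x, z⟫_ℂ).re := by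
    rw [inner_smul_left, Complex.conj_ofReal]
    exact Complex.re_ofReal_mul _ _
  have e7 : ‖(ε : ℂ) • x‖ = ε * ‖x‖ := by
    rw [norm_smul, Complex.norm_real, Real.norm_eq_abs, abs_of_pos hε]
  rw [e5] at e1 e2
  rw [e6, e7] at e3 e4
  rw [map_add, e1, e3] at hu
  rw [map_sub, e2, e4] at hl
  have key : 4 * ε * ‖z‖ ^ 2 ≤ ε * ((ε * ‖x‖) ^ 2 + 2 * (ε * (⟪x, z⟫_ℂ).re) + ‖z‖ ^ 2) := by
    linarith
  have hre : 2 * (ε * (⟪x, z⟫_ℂ).re) ≤ (ε * ‖x‖) ^ 2 + ‖z‖ ^ 2 := by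
    have := sq_nonneg ‖(ε : ℂ) • x - z‖
    rw [e4] at this
    linarith
  have key2 : 4 * ‖z‖ ^ 2 ≤ (ε * ‖x‖) ^ 2 + 2 * (ε * (⟪x, z⟫_ℂ).re) + ‖z‖ ^ 2 :=
    le_of_mul_le_mul_left (by linarith) hε
  exact (sq_le_sq₀ (norm_nonneg _) (by positivity)).1 (by linarith)

theorem sqrt_mem_essentialSpectrum (hA : HasEssentialNormSq A c) (hpos : A.IsPositive)
    (hc : 0 ≤ c) (hH : ¬ FiniteDimensional ℂ H) : ((√c : ℝ) : ℂ) ∈ essentialSpectrum A := by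
  intro hF
  obtain ⟨δ, hδ, M₀, hM₀, h₀⟩ := IsBoundedBelowOnCoFG.of_isFredholm hF
  set s := √c with hs
  have hs0 : 0 ≤ s := Real.sqrt_nonneg c
  rcases hs0.eq_or_lt with hs0 | hs0
  · have hc0 : c = 0 := (Real.sqrt_eq_zero hc).1 hs0.symm
    obtain ⟨M₁, hM₁, h₁⟩ := hA.upper (δ ^ 2 / 2) (by positivity)
    obtain ⟨x, hx, hx0⟩ := (hM₀.inf hM₁).exists_mem_ne_zero hH
    have hn : 0 < ‖x‖ := norm_pos_iff.2 hx0
    have i0 := h₀ x hx.1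
    have i1 := h₁ x hx.2
    rw [← hs0] at i0
    simp only [Complex.ofReal_zero, zero_smul, sub_zero] at i0
    have i2 : (δ * ‖x‖) ^ 2 ≤ ‖A x‖ ^ 2 := by gcongr
    have : 0 < δ ^ 2 * ‖x‖ ^ 2 := by positivity
    rw [hc0] at i1
    linarith
  -- Factor `A² - c = (A + s)(A - s)`. Positivity gives `‖(A + s) y‖ ≥ s‖y‖`, so `A² - c` is bounded
  -- below by `s * δ` on `M₀`, contradicting half that constant as an upper bound.
  · obtain ⟨M₁, hM₁, h₁⟩ := hA.exists_norm_adjoint_sub_le (ε := s * δ / 2) (by positivity)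
    obtain ⟨x, hx, hx0⟩ := (hM₀.inf hM₁).exists_mem_ne_zero hH
    have hn : 0 < ‖x‖ := norm_pos_iff.2 hx0
    have i0 := h₀ x hx.1
    have i1 := h₁ x hx.2
    set y := (A - (s : ℂ) • ContinuousLinearMap.id ℂ H) x with hy
    have hyx : y = A x - (s : ℂ) • x := rfl
    have hz : A.adjoint (A x) - (c : ℂ) • x = A y + (s : ℂ) • y := by
      have hc2 : (c : ℂ) = s * s := by rw [← Complex.ofReal_mul, Real.mul_self_sqrt hc]
      rw [hpos.isSelfAdjoint.adjoint_eq, hyx, map_sub, map_smul, smul_sub, smul_smul, hc2]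
      abel
    rw [hz] at i1
    have i2 := (Complex.re_le_norm _).trans (norm_inner_le_norm (𝕜 := ℂ) (A y + (s : ℂ) • y) y)
    have i3 : (⟪A y + (s : ℂ) • y, y⟫_ℂ).re = (⟪A y, y⟫_ℂ).re + s * ‖y‖ ^ 2 := by
      rw [inner_add_left, inner_smul_left, Complex.conj_ofReal, Complex.add_re,
        Complex.re_ofReal_mul, inner_self_eq_norm_sq_to_K]
      norm_cast
    have i4 : 0 ≤ (⟪A y, y⟫_ℂ).re := hpos.re_inner_nonneg_left y
    have hyn : 0 < ‖y‖ := lt_of_lt_of_le (by positivity) i0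
    have i5 : s * ‖y‖ ≤ ‖A y + (s : ℂ) • y‖ := le_of_mul_le_mul_right (by nlinarith) hyn
    have i6 : s * (δ * ‖x‖) ≤ s * ‖y‖ := by gcongr
    have : 0 < s * δ * ‖x‖ := by positivity
    linarith

theorem notMem_essentialSpectrum (hA : HasEssentialNormSq A c) (hsa : IsSelfAdjoint A)
    {s : ℝ} (hs : 0 ≤ s) (hsc : s < √c) : ((s : ℝ) : ℂ) ∉ essentialSpectrum A := by
  refine not_not.2 (IsBoundedBelowOnCoFG.isFredholm ?_ ?_)
  · obtain ⟨M, hM, h⟩ := hA.lower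
    refine ⟨√c - s, sub_pos.2 hsc, M, hM, fun x hx => ?_⟩
    have i1 : √c * ‖x‖ ≤ ‖A x‖ := by
      rw [← Real.sqrt_sq (norm_nonneg x), ← Real.sqrt_mul' _ (by positivity)]
      exact Real.sqrt_le_iff.2 ⟨norm_nonneg _, h x hx⟩
    have i2 := norm_sub_norm_le (A x) ((s : ℂ) • x)
    rw [norm_smul, Complex.norm_real, Real.norm_eq_abs, abs_of_nonneg hs] at i2
    have i3 : (A - (s : ℂ) • ContinuousLinearMap.id ℂ H) x = A x - (s : ℂ) • x := rfl
    rw [i3]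
    linarith
  · refine hsa.sub (IsSelfAdjoint.smul ?_ (.one _))
    exact Complex.conj_ofReal s

theorem le_of_essentialSpectrum_eq {H₂ : Type*} [NormedAddCommGroup H₂]
    [InnerProductSpace ℂ H₂] [CompleteSpace H₂] {A₂ : H₂ →L[ℂ] H₂} {c₂ : ℝ}
    (hA : HasEssentialNormSq A c) (hA₂ : HasEssentialNormSq A₂ c₂) (hpos : A.IsPositive)
    (hsa : IsSelfAdjoint A₂) (hc : 0 ≤ c) (hH : ¬ FiniteDimensional ℂ H)
    (hess : essentialSpectrum A = essentialSpectrum A₂) : c₂ ≤ c := by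
  by_contra! hlt
  exact hA₂.notMem_essentialSpectrum hsa (Real.sqrt_nonneg c) (Real.sqrt_lt_sqrt hc hlt)
    (hess ▸ hA.sqrt_mem_essentialSpectrum hpos hc hH)

end HasEssentialNormSq

/-! ### Finite-rank off-diagonal blocks -/

theorem IsFiniteRank.cofg_ker {H K : Type*} [NormedAddCommGroup H] [InnerProductSpace ℂ H]
    [NormedAddCommGroup K] [InnerProductSpace ℂ K] {X : H →L[ℂ] K} (hX : IsFiniteRank X) :
    X.ker.CoFG :=
  Submodule.range_fg_iff_ker_cofg.1 (Module.Finite.iff_fg.1 hX)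

theorem IsFiniteRank.cofg_ker_adjoint {H K : Type*} [NormedAddCommGroup H]
    [InnerProductSpace ℂ H] [CompleteSpace H] [NormedAddCommGroup K] [InnerProductSpace ℂ K]
    [CompleteSpace K] {X : H →L[ℂ] K} (hX : IsFiniteRank X) : X.adjoint.ker.CoFG := by
  have : FiniteDimensional ℂ X.range := hX
  rw [← ContinuousLinearMap.orthogonal_range]
  exact Submodule.FG.cofg_of_isCompl X.range.isCompl_orthogonal (Module.Finite.iff_fg.1 this)

/-- Finite rank off-diagonal blocks do not affect the essential value of `‖T x‖²`. -/
theorem HasEssentialNormSq.blockOperator {H₁ H₂ : Type*}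
    [NormedAddCommGroup H₁] [InnerProductSpace ℂ H₁]
    [NormedAddCommGroup H₂] [InnerProductSpace ℂ H₂]
    {A : H₁ →L[ℂ] H₁} {B : H₂ →L[ℂ] H₁} {C : H₁ →L[ℂ] H₂} {D : H₂ →L[ℂ] H₂} {c : ℝ}
    (hA : HasEssentialNormSq A c) (hD : HasEssentialNormSq D c) (hB : B.ker.CoFG)
    (hC : C.ker.CoFG) : HasEssentialNormSq (blockOperator A B C D) c := by
  have hcomap : ∀ {M₁ : Submodule ℂ H₁} {M₂ : Submodule ℂ H₂}, M₁.CoFG → M₂.CoFG →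
      ((M₁ ⊓ C.ker).comap (WithLp.fstₗ 2 ℂ H₁ H₂) ⊓
        (M₂ ⊓ B.ker).comap (WithLp.sndₗ 2 ℂ H₁ H₂)).CoFG := fun h₁ h₂ =>
    ((h₁.inf hC).comap_linearMap _).inf ((h₂.inf hB).comap_linearMap _)
  have hnorm : ∀ v : WithLp 2 (H₁ × H₂), C v.fst = 0 → B v.snd = 0 →
      ‖_root_.blockOperator A B C D v‖ ^ 2 = ‖A v.fst‖ ^ 2 + ‖D v.snd‖ ^ 2 := by
    rintro ⟨x, y⟩ hx hy
    have hx : C x = 0 := hx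
    have hy : B y = 0 := hy
    rw [blockOperator_apply, WithLp.prod_norm_sq_eq_of_L2]
    simp [hx, hy]
  refine ⟨fun ε hε => ?_, ?_⟩
  · obtain ⟨M₁, hM₁, h₁⟩ := hA.upper ε hε
    obtain ⟨M₂, hM₂, h₂⟩ := hD.upper ε hε
    refine ⟨_, hcomap hM₁ hM₂, fun v hv => ?_⟩
    rw [hnorm v hv.1.2 hv.2.2, WithLp.prod_norm_sq_eq_of_L2, mul_add]
    exact add_le_add (h₁ _ hv.1.1) (h₂ _ hv.2.1)
  · obtain ⟨M₁, hM₁, h₁⟩ := hA.lower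
    obtain ⟨M₂, hM₂, h₂⟩ := hD.lower
    refine ⟨_, hcomap hM₁ hM₂, fun v hv => ?_⟩
    rw [hnorm v hv.1.2 hv.2.2, WithLp.prod_norm_sq_eq_of_L2, mul_add]
    exact add_le_add (h₁ _ hv.1.1) (h₂ _ hv.2.1)

theorem mainTheorem4 {H₁ H₂ : Type*}
    [NormedAddCommGroup H₁] [InnerProductSpace ℂ H₁] [CompleteSpace H₁]
    [TopologicalSpace.SeparableSpace H₁]
    [NormedAddCommGroup H₂] [InnerProductSpace ℂ H₂] [CompleteSpace H₂]
    [TopologicalSpace.SeparableSpace H₂]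
    (hH₁ : ¬ FiniteDimensional ℂ H₁) (hH₂ : ¬ FiniteDimensional ℂ H₂)
    (A₁ : H₁ →L[ℂ] H₁) (A₂ : H₂ →L[ℂ] H₂) (X : H₂ →L[ℂ] H₁)
    (hA₁ : A₁.IsPositive) (hA₂ : A₂.IsPositive)
    (hT : (blockOperator A₁ X (ContinuousLinearMap.adjoint X) A₂).IsPositive)
    (hAN₁ : IsAbsolutelyNormAttaining A₁) (hAN₂ : IsAbsolutelyNormAttaining A₂)
    (hess : essentialSpectrum A₁ = essentialSpectrum A₂)
    (hX : IsFiniteRank X) :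
    IsAbsolutelyNormAttaining (blockOperator A₁ X (ContinuousLinearMap.adjoint X) A₂) := by
  obtain ⟨c₁, hc₁, h₁⟩ := hAN₁.exists_hasEssentialNormSq hH₁
  obtain ⟨c₂, hc₂, h₂⟩ := hAN₂.exists_hasEssentialNormSq hH₂
  have hc : c₁ = c₂ := le_antisymm
    (h₂.le_of_essentialSpectrum_eq h₁ hA₂ hA₁.isSelfAdjoint hc₂ hH₂ hess.symm)
    (h₁.le_of_essentialSpectrum_eq h₂ hA₁ hA₂.isSelfAdjoint hc₁ hH₁ hess)
  subst hc
  exact (h₁.blockOperator h₂ hX.cofg_ker hX.cofg_ker_adjoint).isAbsolutelyNormAttaining
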